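/- For every $d\in\mathbb N=\{1,2,\dots\}$ let $C_\gamma\ge\gamma_{d,1}\ge\dots\ge\gamma_{d,d}>0$ be generator weights, with $C_\gamma$ independent of $d$, and put $$p(\gamma)=\inf\Big\{\kappa\ge 0:\ \limsup_{d\to\infty}\sum_{j=1}^d\gamma_{d,j}^\kappa<\infty\Big\},\qquad q(\gamma)=\inf\Big\{\kappa\ge 0:\ \limsup_{d\to\infty}\frac{\sum_{j=1}^d\gamma_{d,j}^\kappa}{\ln(d+1)}<\infty\Big\},\qquad \inf\emptyset=\infty.$$ Let $\mathcal H_1^{\gamma}$, $\gamma>0$, be the space of absolutely continuous $f\colon[0,1]\to\mathbb R$ with $f'\in L_2([0,1])$ and inner product $\langle f,g\rangle=\int_0^1 fg+\gamma^{-1}\int_0^1 f'g'$, and let $\mathcal H_d^\gamma=\mathcal H_1^{\gamma_{d,1}}\otimes\dots\otimes\mathcal H_1^{\gamma_{d,d}}$ be the Hilbert space tensor product, the unanchored weighted Sobolev space of functions on $[0,1]^d$, whose norm is $$\|f\|_{\mathcal H_d^\gamma}^2=\sum_{u\subseteq\{1,\dots,d\}}\ \prod_{k\in u}\gamma_{d,k}^{-1}\int_{[0,1]^d}\Big|\frac{\partial^{|u|}f}{\partial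 x_u}(x)\Big|^2\,dx .$$ As usual, functions that agree almost everywhere are identified in $\mathcal H_d^\gamma$ and in $L_\infty([0,1]^d)$. Let $(F_d^\gamma)_{d\in\mathbb N}$ be Banach spaces of real-valued functions on $[0,1]^d$. Suppose that there are constants $a>0$, $b\ge 0$ and $t\in(0,1]$, independent of $d$, such that for every $d\in\mathbb N$ the space $F_d^\gamma$ is contained in $\mathcal H_d^\gamma$ and $$\|f\|_{\mathcal H_d^\gamma}\le a\,\exp\Big(b\sum_{j=1}^d\gamma_{d,j}^t\Big)\,\|f\|_{F_d^\gamma}\qquad\text{for all } f\in F_d^\gamma .$$ For $\varepsilon>0$ let $n(\varepsilon,d)$ be the least $n\in\mathbb N_0$ for which there are continuous linear functionals $L_1,\dots,L_n$ on $F_d^\gamma$ and $g_1,\dots,g_n\in L_\infty([0,1]^d)$ with $$\sup_{\|f\|_{F_d^\gamma}\le 1}\Big\|f-\sum_{j=1}^n L_j(f)\,g_j\Big\|_{L_\infty([0,1]^d)}\le\varepsilon .$$ Then: 1. If $q(\gamma)<t$, then $L_\infty$-approximation over $(F_d^\gamma)_{d}$ by linear algorithms is polynomially tractable: there are $C,p>0$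 and $q\ge 0$ such that $n(\varepsilon,d)\le C\,\varepsilon^{-p}\,d^{\,q}$ for all $d\in\mathbb N$ and $\varepsilon\in(0,1]$. 2. If $p(\gamma)<t$, then it is strongly polynomially tractable: there are $C,p>0$ such that $n(\varepsilon,d)\le C\,\varepsilon^{-p}$ for all $d\in\mathbb N$ and $\varepsilon\in(0,1]$. In particular, under the respective condition, $n(\varepsilon,d)$ is finite for all these $d$ and $\varepsilon$. -/

import Mathlib

open MeasureTheory Filter
open scoped ENNReal

namespace LinftyApp

noncomputable section

/-- The unit cube `[0,1]^d`. Its canonical measure `volume` is the product of the Lebesgue measures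
on the factors `[0,1]`, that is, the `d`-dimensional Lebesgue measure. -/
abbrev Cube (d : ℕ) : Type := Fin d → unitInterval

/-- The space `L_∞([0,1]^d)`. -/
abbrev Linfty (d : ℕ) : Type := Lp ℝ ∞ (volume : Measure (Cube d))

/-! ### The unanchored weighted Sobolev space -/

/-- The functions of the univariate Sobolev space: `f` is absolutely continuous on `[0,1]` and its
derivative (which exists almost everywhere) is square integrable there. -/
def MemSobolev1 (f : ℝ → ℝ) : Prop :=
  AbsolutelyContinuousOnInterval f 0 1 ∧
    MemLp (deriv f) 2 (volume.restrict (Set.Icc (0 : ℝ) 1))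

/-- The mixed derivative `∂^{|u|}/∂x_u`, `u ⊆ {1,…,d}`, of the simple tensor
`x ↦ f₁(x₁) ⋯ f_d(x_d)`; for `u = ∅` this is the simple tensor itself. -/
def tensorDeriv {d : ℕ} (f : Fin d → ℝ → ℝ) (u : Finset (Fin d)) (x : Cube d) : ℝ :=
  ∏ k, if k ∈ u then deriv (f k) (x k) else f k (x k)

/-- The product weight `γ_u = ∏_{k ∈ u} γ_k`. -/
def prodWeight {d : ℕ} (γ : Fin d → ℝ) (u : Finset (Fin d)) : ℝ := ∏ k ∈ u, γ k

/-- The ambient Hilbert space of families `(G_u)_u`, `u ⊆ {1,…,d}`, in `L_2([0,1]^d)`, with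
`‖G‖² = ∑_u ‖G_u‖²`. -/
abbrev MixedL2 (d : ℕ) : Type :=
  PiLp 2 (fun _ : Finset (Fin d) => Lp ℝ 2 (volume : Measure (Cube d)))

/-- The simple tensors `f = f₁ ⊗ ⋯ ⊗ f_d` of univariate Sobolev functions, each identified with
the family `(γ_u^{-1/2} ∂^{|u|}f/∂x_u)_u`. -/
def simpleTensors {d : ℕ} (γ : Fin d → ℝ) : Set (MixedL2 d) :=
  {G | ∃ f : Fin d → ℝ → ℝ, (∀ k, MemSobolev1 (f k)) ∧
    ∀ u, G u =ᵐ[volume] fun x => (Real.sqrt (prodWeight γ u))⁻¹ * tensorDeriv f u x}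

/-- The unanchored weighted Sobolev space `H_d^γ = H_1^{γ_1} ⊗ ⋯ ⊗ H_1^{γ_d}`: the completion of
the algebraic tensor product, the linear span of the simple tensors, with respect to the inner
product `⟨f, g⟩ = ∑_u γ_u⁻¹ ∫ (∂^{|u|}f/∂x_u) (∂^{|u|}g/∂x_u) dx`, which on simple tensors equals
`∏_k (∫₀¹ f_k g_k + γ_k⁻¹ ∫₀¹ f_k' g_k')`. An element `f` is represented by the family
`(γ_u^{-1/2} ∂^{|u|}f/∂x_u)_u`; so the norm inherited from `MixedL2 d` is the norm of `H_d^γ`, and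
the component at `u = ∅` is the function `f` itself. -/
def unanchoredSobolev {d : ℕ} (γ : Fin d → ℝ) : Submodule ℝ (MixedL2 d) :=
  (Submodule.span ℝ (simpleTensors γ)).topologicalClosure

/-- The space `F`, whose elements are regarded as functions on the cube through `ι`, is embedded
into `H_d^γ` with norm at most `M`: every `f ∈ F` belongs to `H_d^γ`, with
`‖f | H_d^γ‖ ≤ M ‖f | F‖`. -/
def EmbedsWithNormLE {d : ℕ} {F : Type*} [NormedAddCommGroup F] [NormedSpace ℝ F]
    (ι : F →ₗ[ℝ] (Cube d → ℝ)) (γ : Fin d → ℝ) (M : ℝ) : Prop :=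
  ∀ f : F, ∃ h ∈ unanchoredSobolev γ, (h ∅ : Cube d → ℝ) =ᵐ[volume] ι f ∧ ‖h‖ ≤ M * ‖f‖

/-! ### Sum exponents -/

/-- `p(γ) = inf {κ ≥ 0 | limsup_d ∑_j γ_{d,j}^κ < ∞}`, with `inf ∅ = ∞`. -/
def sumExponentP (γ : (d : ℕ) → Fin d → ℝ) : EReal :=
  sInf ((fun κ : ℝ => (κ : EReal)) '' {κ : ℝ | 0 ≤ κ ∧
    limsup (fun d : ℕ => ((∑ j, γ d j ^ κ : ℝ) : EReal)) atTop < ⊤})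

/-- `q(γ) = inf {κ ≥ 0 | limsup_d (∑_j γ_{d,j}^κ) / ln (d+1) < ∞}`, with `inf ∅ = ∞`. -/
def sumExponentQ (γ : (d : ℕ) → Fin d → ℝ) : EReal :=
  sInf ((fun κ : ℝ => (κ : EReal)) '' {κ : ℝ | 0 ≤ κ ∧
    limsup (fun d : ℕ => (((∑ j, γ d j ^ κ) / Real.log ((d : ℝ) + 1) : ℝ) : EReal)) atTop < ⊤})

/-! ### Algorithms, worst case error, information complexity, tractability -/

section Complexity

/-- The linear algorithms `A f = ∑_{j=1}^n L_j(f) g_j` with continuous linear functionals `L_j`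
on `F` and `g_j ∈ L_∞([0,1]^d)`. -/
def IsLinearAlgorithm {d : ℕ} {F : Type*} [NormedAddCommGroup F] [NormedSpace ℝ F]
    (n : ℕ) (A : F → Linfty d) : Prop :=
  ∃ (L : Fin n → (F →L[ℝ] ℝ)) (g : Fin n → Linfty d), ∀ f, A f = ∑ j, L j f • g j

/-- The worst case error `sup_{‖f‖ ≤ 1} ‖f - A f | L_∞([0,1]^d)‖`. -/
def worstCaseError {d : ℕ} {F : Type*} [NormedAddCommGroup F] [NormedSpace ℝ F]
    (ι : F →ₗ[ℝ] (Cube d → ℝ)) (A : F → Linfty d) : ℝ≥0∞ :=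
  ⨆ f ∈ Metric.closedBall (0 : F) 1, eLpNorm (fun x => ι f x - A f x) ∞ volume

/-- The information complexity for the absolute error criterion: the least `n` for which some
linear algorithm using `n` functionals has worst case error at most `ε` (`⊤` if there is none). -/
def infoComplexity {d : ℕ} {F : Type*} [NormedAddCommGroup F] [NormedSpace ℝ F]
    (ι : F →ₗ[ℝ] (Cube d → ℝ)) (ε : ℝ) : ℕ∞ :=
  ⨅ n ∈ {n : ℕ | ∃ A : F → Linfty d,
    IsLinearAlgorithm n A ∧ worstCaseError ι A ≤ ENNReal.ofReal ε}, (n : ℕ∞)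

/-- Polynomial tractability: `n(ε,d) ≤ C ε^{-p} d^q` for all `d ≥ 1` and `ε ∈ (0,1]`. -/
def PolynomiallyTractable {F : ℕ → Type*} [∀ d, NormedAddCommGroup (F d)]
    [∀ d, NormedSpace ℝ (F d)] (ι : ∀ d, F d →ₗ[ℝ] (Cube d → ℝ)) : Prop :=
  ∃ C p q : ℝ, 0 < C ∧ 0 < p ∧ 0 ≤ q ∧ ∀ d : ℕ, 1 ≤ d → ∀ ε : ℝ, 0 < ε → ε ≤ 1 →
    (infoComplexity (ι d) ε : ℝ≥0∞) ≤ ENNReal.ofReal (C * ε ^ (-p) * (d : ℝ) ^ q)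

/-- Strong polynomial tractability: `n(ε,d) ≤ C ε^{-p}` for all `d ≥ 1` and `ε ∈ (0,1]`. -/
def StronglyPolynomiallyTractable {F : ℕ → Type*} [∀ d, NormedAddCommGroup (F d)]
    [∀ d, NormedSpace ℝ (F d)] (ι : ∀ d, F d →ₗ[ℝ] (Cube d → ℝ)) : Prop :=
  ∃ C p : ℝ, 0 < C ∧ 0 < p ∧ ∀ d : ℕ, 1 ≤ d → ∀ ε : ℝ, 0 < ε → ε ≤ 1 →
    (infoComplexity (ι d) ε : ℝ≥0∞) ≤ ENNReal.ofReal (C * ε ^ (-p))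

end Complexity

end

end LinftyApp

namespace LinftyApp

/-! The algorithm is a truncated cosine series. The functions `cos (n π x)` have vanishing
derivative at both endpoints, so integration by parts shows that, for `h` in the weighted Sobolev
space, the inner product with the tensor cosine `φ_k` is `w_k c_k`. Here `c_k` is the `L_2` cosine
coefficient of `h` and `w_k = ∏_j (1 + γ_j⁻¹ (π k_j)²)` (`inner_cosMixed`). Hence the `w_k^{-1/2}
φ_k` are orthonormal in that space, and Bessel gives `∑ w_k c_k² ≤ ‖h‖²`; their completeness there
is not needed. With completeness of the cosines in `L_2` and Cauchy–Schwarz, truncation to a finite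
set `K` has uniform error at most `(∑_{k ∉ K} m_k / w_k)^{1/2} ‖h‖`, where `m_k = ∏_j cosScale
(k_j)²` bounds `‖φ_k‖_∞²` (`eLpNorm_sub_cosSum_le`).

Take `K = {w_k ≤ T}`. For `1/2 < τ < 1` the sum `∑ m_k w_k^{-τ}` factors over the coordinates and is
at most `exp (D ∑_j γ_j^τ)`; this one bound controls both `|K|` and the tail. Optimizing `T` and
inserting the embedding constant bounds the complexity by a power of `ε⁻¹` times an exponential in
`∑_j γ_j^κ`, for any `κ < t` (`exists_infoComplexity_le`). If `∑_j γ_j^κ` is `O(ln (d+1))`, the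
exponential is a power of `d`; if it is bounded, so is the exponential. -/

/-! ### The univariate cosine system -/

/-- The factor that normalizes `x ↦ cos (n π x)` in `L_2([0,1])`. -/
noncomputable def cosScale (n : ℕ) : ℝ := if n = 0 then 1 else Real.sqrt 2

/-- The `L_2([0,1])`-normalized cosine `x ↦ cos (n π x)`. -/
noncomputable def cosBasis (n : ℕ) (x : ℝ) : ℝ := cosScale n * Real.cos (n * Real.pi * x)

lemma cosScale_sq (n : ℕ) : cosScale n ^ 2 = if n = 0 then 1 else 2 := by
  unfold cosScale; split_ifs <;> simp

lemma cosScale_pos (n : ℕ) : 0 < cosScale n := by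
  unfold cosScale; split_ifs <;> positivity

lemma abs_cosBasis_le (n : ℕ) (x : ℝ) : |cosBasis n x| ≤ cosScale n := by
  rw [cosBasis, abs_mul, abs_of_pos (cosScale_pos n)]
  exact mul_le_of_le_one_right (cosScale_pos n).le (Real.abs_cos_le_one _)

lemma cosBasis_zero (x : ℝ) : cosBasis 0 x = 1 := by simp [cosBasis, cosScale]

lemma contDiff_cosBasis (n : ℕ) : ContDiff ℝ 2 (cosBasis n) := by
  unfold cosBasis; fun_prop

lemma deriv_cosBasis (n : ℕ) :
    deriv (cosBasis n) = fun x => -(cosScale n * (n * Real.pi)) * Real.sin (n * Real.pi * x) := by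
  funext x
  have h : HasDerivAt (fun x : ℝ => (n : ℝ) * Real.pi * x) (n * Real.pi) x := by
    simpa using (hasDerivAt_id x).const_mul ((n : ℝ) * Real.pi)
  have h2 := (h.cos.const_mul (cosScale n)).deriv
  unfold cosBasis
  rw [h2]; ring

lemma deriv_deriv_cosBasis (n : ℕ) (x : ℝ) :
    deriv (deriv (cosBasis n)) x = -(n * Real.pi) ^ 2 * cosBasis n x := by
  have h : HasDerivAt (fun x : ℝ => (n : ℝ) * Real.pi * x) (n * Real.pi) x := by
    simpa using (hasDerivAt_id x).const_mul ((n : ℝ) * Real.pi)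
  have h2 := (h.sin.const_mul (-(cosScale n * (n * Real.pi)))).deriv
  rw [deriv_cosBasis, h2, cosBasis]; ring

lemma _root_.ContDiff.absolutelyContinuousOnInterval {f : ℝ → ℝ} (hf : ContDiff ℝ 1 f) (a b : ℝ) :
    AbsolutelyContinuousOnInterval f a b :=
  hf.contDiffOn.absolutelyContinuousOnInterval

lemma memSobolev1_cosBasis (n : ℕ) : MemSobolev1 (cosBasis n) := by
  refine ⟨((contDiff_cosBasis n).of_le one_le_two).absolutelyContinuousOnInterval 0 1, ?_⟩
  refine MemLp.of_bound (C := |cosScale n * (n * Real.pi)|) ?_ ?_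
  · rw [deriv_cosBasis]
    exact Continuous.aestronglyMeasurable (by fun_prop)
  · refine ae_of_all _ fun x => ?_
    rw [deriv_cosBasis, Real.norm_eq_abs, abs_mul, abs_neg]
    exact mul_le_of_le_one_right (abs_nonneg _) (Real.abs_sin_le_one _)

lemma integral_unitInterval_eq (f : ℝ → ℝ) :
    ∫ x : unitInterval, f x = ∫ x in (0 : ℝ)..1, f x := by
  rw [intervalIntegral.integral_of_le zero_le_one, ← integral_Icc_eq_integral_Ioc]
  exact integral_subtype_comap measurableSet_Icc f

/-- Integration by parts against a cosine, whose derivative vanishes at both endpoints. -/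
lemma integral_deriv_cosBasis_mul_deriv (n : ℕ) {f : ℝ → ℝ}
    (hf : AbsolutelyContinuousOnInterval f 0 1) :
    ∫ x : unitInterval, deriv (cosBasis n) x * deriv f x =
      (n * Real.pi) ^ 2 * ∫ x : unitInterval, cosBasis n x * f x := by
  have hd : ContDiff ℝ 1 (deriv (cosBasis n)) := by
    rw [deriv_cosBasis]; fun_prop
  have h := AbsolutelyContinuousOnInterval.integral_mul_deriv_eq_deriv_mul
    (hd.absolutelyContinuousOnInterval 0 1) hf
  rw [integral_unitInterval_eq (fun x => deriv (cosBasis n) x * deriv f x),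
    integral_unitInterval_eq (fun x => cosBasis n x * f x), h]
  have h0 : deriv (cosBasis n) 0 = 0 := by simp [deriv_cosBasis]
  have h1 : deriv (cosBasis n) 1 = 0 := by simp [deriv_cosBasis, Real.sin_nat_mul_pi]
  simp only [h0, h1, deriv_deriv_cosBasis, mul_assoc]
  rw [intervalIntegral.integral_const_mul]
  ring

/-- Integrating by parts in either order gives the same integral with eigenvalue `(m π)²` or `(n
π)²`, so the integral vanishes when these differ. -/
lemma integral_cosBasis_mul_of_ne {m n : ℕ} (h : m ≠ n) :
    ∫ x : unitInterval, cosBasis m x * cosBasis n x = 0 := by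
  have h1 := integral_deriv_cosBasis_mul_deriv m (memSobolev1_cosBasis n).1
  have h2 := integral_deriv_cosBasis_mul_deriv n (memSobolev1_cosBasis m).1
  simp_rw [mul_comm (deriv (cosBasis n) _), mul_comm (cosBasis n _)] at h2
  rw [h1, ← sub_eq_zero, ← sub_mul, mul_eq_zero] at h2
  refine h2.resolve_left fun h3 => h ?_
  rw [mul_pow, mul_pow, ← sub_mul, mul_eq_zero, sub_eq_zero] at h3
  have h4 := h3.resolve_right (by positivity)
  have h5 := (sq_eq_sq₀ (Nat.cast_nonneg m) (Nat.cast_nonneg n)).1 h4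
  exact_mod_cast h5

lemma integral_cosBasis_mul_self (n : ℕ) :
    ∫ x : unitInterval, cosBasis n x * cosBasis n x = 1 := by
  rcases eq_or_ne n 0 with rfl | hn
  · simp [cosBasis_zero]
  · have h2 : (0 : ℕ) ≠ 2 * n := by omega
    have h3 := integral_cosBasis_mul_of_ne h2
    -- The double-angle formula reduces the norm to orthogonality of the frequencies `0` and `2 n`.
    have h4 : (fun x : unitInterval => cosBasis n x * cosBasis n x) =
        fun x : unitInterval => 1 + (Real.sqrt 2)⁻¹ * (cosBasis 0 x * cosBasis (2 * n) x) := by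
      funext x
      have h5 := Real.sq_sqrt (zero_le_two (α := ℝ))
      rw [cosBasis_zero, cosBasis, cosBasis, cosScale, cosScale, if_neg hn, if_neg (by omega)]
      have h6 : ((2 * n : ℕ) : ℝ) * Real.pi * x = 2 * (n * Real.pi * x) := by push_cast; ring
      rw [h6, Real.cos_two_mul]
      field_simp
      rw [h5]; ring
    rw [h4, integral_add (integrable_const _), integral_const_mul, h3]
    · simp
    · refine Continuous.integrable_of_hasCompactSupport ?_ (HasCompactSupport.of_compactSpace _)
      unfold cosBasis; fun_prop

lemma integral_cosBasis_mul_cosBasis (m n : ℕ) :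
    ∫ x : unitInterval, cosBasis m x * cosBasis n x = if m = n then 1 else 0 := by
  split_ifs with h
  · rw [h, integral_cosBasis_mul_self]
  · exact integral_cosBasis_mul_of_ne h

/-! ### The multivariate cosine system -/

variable {d : ℕ}

/-- The tensor product cosine `x ↦ ∏_j cosBasis (k_j) (x_j)`. -/
noncomputable def cosTensor (k : Fin d → ℕ) : C(Cube d, ℝ) where
  toFun x := ∏ j, cosBasis (k j) (x j)
  continuous_toFun := by
    have h := fun n => (contDiff_cosBasis n).continuous
    fun_prop

lemma norm_cosTensor_le (k : Fin d → ℕ) : ‖cosTensor k‖ ≤ ∏ j, cosScale (k j) := by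
  refine (ContinuousMap.norm_le _ (Finset.prod_nonneg fun j _ => (cosScale_pos _).le)).2 fun x => ?_
  rw [cosTensor, ContinuousMap.coe_mk, norm_prod]
  exact Finset.prod_le_prod (fun _ _ => norm_nonneg _) fun j _ => abs_cosBasis_le _ _

/-- The tensor product cosine as an element of `L_2`. -/
noncomputable def cosL2 (k : Fin d → ℕ) : Lp ℝ 2 (volume : Measure (Cube d)) :=
  ContinuousMap.toLp 2 volume ℝ (cosTensor k)

lemma coeFn_cosL2 (k : Fin d → ℕ) : cosL2 k =ᵐ[volume] fun x => ∏ j, cosBasis (k j) (x j) :=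
  ContinuousMap.coeFn_toLp volume (cosTensor k)

lemma orthonormal_cosL2 :
    Orthonormal ℝ (cosL2 : (Fin d → ℕ) → Lp ℝ 2 (volume : Measure (Cube d))) := by
  classical
  rw [orthonormal_iff_ite]
  intro k l
  have h : inner ℝ (cosL2 k) (cosL2 l) =
      ∫ x : Cube d, ∏ j, (cosBasis (k j) (x j) * cosBasis (l j) (x j)) := by
    rw [L2.inner_def]
    refine integral_congr_ae ?_
    filter_upwards [coeFn_cosL2 k, coeFn_cosL2 l] with x hk hl
    rw [hk, hl, Finset.prod_mul_distrib]
    simp [mul_comm]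
  rw [h, integral_fintype_prod_volume_eq_prod
    (fun j (y : unitInterval) => cosBasis (k j) y * cosBasis (l j) y)]
  simp_rw [integral_cosBasis_mul_cosBasis]
  rw [Finset.prod_ite_zero]
  simp [funext_iff]

/-- The product-to-sum formula holds in each coordinate; expanding the product over coordinates
gives one tensor cosine for each choice of sum or difference frequency. -/
lemma cosTensor_mul_mem_span (k l : Fin d → ℕ) :
    cosTensor k * cosTensor l ∈ Submodule.span ℝ (Set.range (cosTensor (d := d))) := by
  classical
  have h1 : ∀ (m n : ℕ), ∃ (p : Bool → ℕ) (c : Bool → ℝ), ∀ x,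
      cosBasis m x * cosBasis n x = ∑ i, c i * cosBasis (p i) x := by
    intro m n
    -- The difference frequency uses truncated subtraction, which is genuine only for `n ≤ m`.
    wlog hmn : n ≤ m generalizing m n
    · obtain ⟨p, c, h⟩ := this n m (le_of_not_ge hmn)
      exact ⟨p, c, fun x => by rw [mul_comm, h]⟩
    refine ⟨fun i => if i then m + n else m - n, fun i => cosScale m * cosScale n / 2 *
      (cosScale (if i then m + n else m - n))⁻¹, fun x => ?_⟩
    have hp := (cosScale_pos (m + n)).ne'
    have hq := (cosScale_pos (m - n)).ne'
    simp only [Fintype.sum_bool, cosBasis, if_true, Bool.false_eq_true, if_false]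
    have ha : ((m + n : ℕ) : ℝ) * Real.pi * x = m * Real.pi * x + n * Real.pi * x := by
      push_cast; ring
    have hb : ((m - n : ℕ) : ℝ) * Real.pi * x = m * Real.pi * x - n * Real.pi * x := by
      rw [Nat.cast_sub hmn]; ring
    rw [ha, hb, Real.cos_add, Real.cos_sub]
    field_simp
    ring
  choose p c hpc using fun j => h1 (k j) (l j)
  have h2 : cosTensor k * cosTensor l =
      ∑ i : Fin d → Bool, (∏ j, c j (i j)) • cosTensor (fun j => p j (i j)) := by
    ext x
    simp only [cosTensor, ContinuousMap.coe_mul, ContinuousMap.coe_mk, Pi.mul_apply,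
      ContinuousMap.coe_sum, Finset.sum_apply, ContinuousMap.coe_smul, Pi.smul_apply, smul_eq_mul,
      ← Finset.prod_mul_distrib, hpc]
    rw [Finset.prod_univ_sum, Fintype.piFinset_univ]
  rw [h2]
  exact Submodule.sum_mem _ fun i _ => Submodule.smul_mem _ _ (Submodule.subset_span ⟨_, rfl⟩)

/-- The linear span of the tensor product cosines, an algebra of continuous functions. -/
noncomputable def cosSubalgebra (d : ℕ) : Subalgebra ℝ C(Cube d, ℝ) :=
  (Submodule.span ℝ (Set.range (cosTensor (d := d)))).toSubalgebra
    (Submodule.subset_span ⟨0, by ext x; simp [cosTensor, cosBasis_zero]⟩)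
    (fun f g hf hg => by
      induction hf, hg using Submodule.span_induction₂ with
      | mem_mem x y hx hy =>
        obtain ⟨k, rfl⟩ := hx
        obtain ⟨l, rfl⟩ := hy
        exact cosTensor_mul_mem_span k l
      | zero_left y hy => simp
      | zero_right x hx => simp
      | add_left x y z hx hy hz h1 h2 => rw [add_mul]; exact Submodule.add_mem _ h1 h2
      | add_right x y z hx hy hz h1 h2 => rw [mul_add]; exact Submodule.add_mem _ h1 h2
      | smul_left r x y hx hy h => rw [smul_mul_assoc]; exact Submodule.smul_mem _ _ h
      | smul_right r x y hx hy h => rw [mul_smul_comm]; exact Submodule.smul_mem _ _ h)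

/-- Frequency `1` in a coordinate where the points differ, and `0` elsewhere, suffices, since `cos`
is injective on `[0, π]`. -/
lemma cosSubalgebra_separatesPoints : (cosSubalgebra d).SeparatesPoints := by
  classical
  intro x y hxy
  obtain ⟨j, hj⟩ := Function.ne_iff.1 hxy
  refine ⟨_, ⟨cosTensor (Pi.single j 1), Submodule.subset_span ⟨_, rfl⟩, rfl⟩, fun h => hj ?_⟩
  have h1 : ∀ z : Cube d, cosTensor (Pi.single j 1) z = cosBasis 1 (z j) := by
    intro z
    rw [cosTensor, ContinuousMap.coe_mk, Finset.prod_eq_single j]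
    · simp
    · intro i _ hi; simp [hi, cosBasis_zero]
    · simp
  replace h := (h1 x).symm.trans (h.trans (h1 y))
  rw [cosBasis, cosBasis] at h
  have h2 := mul_left_cancel₀ (cosScale_pos 1).ne' h
  have hmem : ∀ z : unitInterval, ((1 : ℕ) : ℝ) * Real.pi * z ∈ Set.Icc 0 Real.pi := fun z =>
    ⟨by have := z.2.1; positivity, by
      rw [Nat.cast_one, one_mul]; exact mul_le_of_le_one_right Real.pi_pos.le z.2.2⟩
  have h3 := Real.injOn_cos (hmem _) (hmem _) h2
  exact Subtype.ext (mul_left_cancel₀ (by positivity) h3)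

/-- Stone–Weierstrass gives density in the continuous functions, which are dense in `L_2`. -/
lemma span_cosL2_closure_eq_top :
    (Submodule.span ℝ (Set.range (cosL2 (d := d)))).topologicalClosure = ⊤ := by
  have h := ContinuousMap.subalgebra_topologicalClosure_eq_top_of_separatesPoints
    (cosSubalgebra d) cosSubalgebra_separatesPoints
  have h1 : (Submodule.span ℝ (Set.range (cosTensor (d := d)))).topologicalClosure = ⊤ :=
    congrArg Subalgebra.toSubmodule h
  have h2 := (ContinuousMap.toLp_denseRange ℝ (volume : Measure (Cube d)) ℝ
    (p := 2) (by norm_num)).topologicalClosure_map_submodule h1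
  rw [Submodule.map_span, ← Set.range_comp] at h2
  exact h2

/-- The tensor product cosines form a Hilbert basis of `L_2([0,1]^d)`. -/
noncomputable def cosHilbertBasis (d : ℕ) :
    HilbertBasis (Fin d → ℕ) ℝ (Lp ℝ 2 (volume : Measure (Cube d))) :=
  HilbertBasis.mk orthonormal_cosL2 span_cosL2_closure_eq_top.ge

/-! ### The cosine system in the weighted Sobolev space -/

/-- The squared norm of the tensor product cosine in the weighted Sobolev space. -/
noncomputable def cosWeight (γ : Fin d → ℝ) (k : Fin d → ℕ) : ℝ :=
  ∏ j, (1 + (γ j)⁻¹ * (k j * Real.pi) ^ 2)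

lemma one_le_cosWeight {γ : Fin d → ℝ} (hγ : ∀ j, 0 < γ j) (k : Fin d → ℕ) :
    1 ≤ cosWeight γ k :=
  Finset.one_le_prod (s := Finset.univ) fun j _ => by have := hγ j; simp; positivity

/-- The tensor product cosine as an element of the weighted Sobolev space. -/
noncomputable def cosMixed (γ : Fin d → ℝ) (k : Fin d → ℕ) : MixedL2 d :=
  WithLp.toLp 2 fun u => ContinuousMap.toLp 2 volume ℝ
    { toFun := fun x => (Real.sqrt (prodWeight γ u))⁻¹ * tensorDeriv (fun j => cosBasis (k j)) u x
      continuous_toFun := by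
        unfold tensorDeriv
        refine continuous_const.mul (continuous_finsetProd _ fun j _ => ?_)
        have h := (contDiff_cosBasis (k j)).continuous
        split_ifs
        · rw [deriv_cosBasis]; fun_prop
        · fun_prop }

lemma coeFn_cosMixed (γ : Fin d → ℝ) (k : Fin d → ℕ) (u : Finset (Fin d)) :
    cosMixed γ k u =ᵐ[volume]
      fun x => (Real.sqrt (prodWeight γ u))⁻¹ * tensorDeriv (fun j => cosBasis (k j)) u x :=
  ContinuousMap.coeFn_toLp volume _

lemma cosMixed_mem (γ : Fin d → ℝ) (k : Fin d → ℕ) : cosMixed γ k ∈ unanchoredSobolev γ :=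
  Submodule.le_topologicalClosure _ (Submodule.subset_span
    ⟨_, fun j => memSobolev1_cosBasis (k j), coeFn_cosMixed γ k⟩)

lemma cosMixed_empty (γ : Fin d → ℝ) (k : Fin d → ℕ) : cosMixed γ k ∅ = cosL2 k := by
  refine Lp.ext ?_
  filter_upwards [coeFn_cosMixed γ k ∅, coeFn_cosL2 k] with x h1 h2
  rw [h1, h2]
  simp [prodWeight, tensorDeriv]

/-- On the weighted Sobolev space, the inner product with a tensor product cosine is a multiple of
the corresponding cosine coefficient. -/
lemma inner_cosMixed {γ : Fin d → ℝ} (hγ : ∀ j, 0 < γ j) (k : Fin d → ℕ) {h : MixedL2 d}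
    (hh : h ∈ unanchoredSobolev γ) :
    inner ℝ (cosMixed γ k) h = cosWeight γ k * inner ℝ (cosL2 k) (h ∅) := by
  classical
  let φ : MixedL2 d →L[ℝ] ℝ := innerSL ℝ (cosMixed γ k) -
    cosWeight γ k • (innerSL ℝ (cosL2 k) ∘L PiLp.proj 2 (𝕜 := ℝ) _ ∅)
  have hφ : ∀ G, φ G = inner ℝ (cosMixed γ k) G - cosWeight γ k * inner ℝ (cosL2 k) (G ∅) :=
    fun G => rfl
  -- Both sides are continuous and linear in `h`, so it is enough to check simple tensors.
  suffices hle : unanchoredSobolev γ ≤ LinearMap.ker φ.toLinearMap by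
    exact sub_eq_zero.1 ((hφ h).symm.trans (hle hh))
  refine Submodule.topologicalClosure_minimal _ (Submodule.span_le.2 ?_) φ.isClosed_ker
  rintro G ⟨f, hf, hG⟩
  have key : ∀ u, inner ℝ (cosMixed γ k u) (G u) = ∏ j, if j ∈ u then
      (γ j)⁻¹ * ((k j * Real.pi) ^ 2 * ∫ x : unitInterval, cosBasis (k j) x * f j x) else
      ∫ x : unitInterval, cosBasis (k j) x * f j x := by
    intro u
    have hpos : 0 < prodWeight γ u := Finset.prod_pos fun j _ => hγ j
    have h1 : inner ℝ (cosMixed γ k u) (G u) = (prodWeight γ u)⁻¹ * ∫ x : Cube d, ∏ j,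
        (fun y : unitInterval => if j ∈ u then deriv (cosBasis (k j)) y * deriv (f j) y else
          cosBasis (k j) y * f j y) (x j) := by
      rw [L2.inner_def, ← integral_const_mul]
      refine integral_congr_ae ?_
      filter_upwards [coeFn_cosMixed γ k u, hG u] with x hx hx'
      have h2 : ∀ j, (if j ∈ u then deriv (cosBasis (k j)) (x j) * deriv (f j) (x j) else
          cosBasis (k j) (x j) * f j (x j)) =
          (if j ∈ u then deriv (cosBasis (k j)) (x j) else cosBasis (k j) (x j)) *
          (if j ∈ u then deriv (f j) (x j) else f j (x j)) := by
        intro j; split_ifs <;> rfl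
      have h3 : (prodWeight γ u)⁻¹ =
          (Real.sqrt (prodWeight γ u))⁻¹ * (Real.sqrt (prodWeight γ u))⁻¹ := by
        rw [← mul_inv, Real.mul_self_sqrt hpos.le]
      simp only [h2, Finset.prod_mul_distrib]
      rw [hx, hx', h3, RCLike.inner_apply, conj_trivial, tensorDeriv, tensorDeriv]
      ring
    rw [h1, integral_fintype_prod_volume_eq_prod
      (fun j (y : unitInterval) => if j ∈ u then deriv (cosBasis (k j)) y * deriv (f j) y else
          cosBasis (k j) y * f j y)]
    have h4 : (prodWeight γ u)⁻¹ = ∏ j, if j ∈ u then (γ j)⁻¹ else 1 := by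
      rw [prodWeight, ← Finset.prod_inv_distrib, Finset.prod_ite_mem, Finset.univ_inter]
    rw [h4, ← Finset.prod_mul_distrib]
    refine Finset.prod_congr rfl fun j _ => ?_
    split_ifs
    · rw [integral_deriv_cosBasis_mul_deriv _ (hf j).1]
    · rw [one_mul]
  change φ G = 0
  rw [hφ, sub_eq_zero, ← cosMixed_empty γ, key, PiLp.inner_apply]
  simp_rw [key]
  have h5 : ∀ u : Finset (Fin d), (∏ j, if j ∈ u then
      (γ j)⁻¹ * ((k j * Real.pi) ^ 2 * ∫ x : unitInterval, cosBasis (k j) x * f j x) else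
      ∫ x : unitInterval, cosBasis (k j) x * f j x) =
      (∏ j ∈ u, (γ j)⁻¹ * ((k j * Real.pi) ^ 2 * ∫ x : unitInterval, cosBasis (k j) x * f j x)) *
      ∏ j ∈ Finset.univ \ u, ∫ x : unitInterval, cosBasis (k j) x * f j x := by
    intro u
    rw [Finset.prod_ite]
    congr 1 <;> exact Finset.prod_congr (by ext; simp) fun _ _ => rfl
  simp_rw [h5]
  -- The sum over all `u` is the expansion of `∏_j (A_j + B_j)`, with derivative terms `A_j` and
  -- plain terms `B_j`.
  rw [← Finset.powerset_univ, ← Finset.prod_add, cosWeight, Finset.prod_empty, one_mul,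
    Finset.sdiff_empty, ← Finset.prod_mul_distrib]
  exact Finset.prod_congr rfl fun j _ => by ring

/-- Bessel's inequality for the cosine system in the weighted Sobolev space. -/
lemma sum_cosWeight_mul_sq_le {γ : Fin d → ℝ} (hγ : ∀ j, 0 < γ j) {h : MixedL2 d}
    (hh : h ∈ unanchoredSobolev γ) (s : Finset (Fin d → ℕ)) :
    ∑ k ∈ s, cosWeight γ k * inner ℝ (cosL2 k) (h ∅) ^ 2 ≤ ‖h‖ ^ 2 := by
  classical
  have hw : ∀ k, 0 < cosWeight γ k := fun k => zero_lt_one.trans_le (one_le_cosWeight hγ k)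
  have hsq : ∀ k, Real.sqrt (cosWeight γ k) ^ 2 = cosWeight γ k := fun k => Real.sq_sqrt (hw k).le
  have hs : ∀ k, Real.sqrt (cosWeight γ k) ≠ 0 := fun k => (Real.sqrt_pos.2 (hw k)).ne'
  have ho : Orthonormal ℝ fun k => (Real.sqrt (cosWeight γ k))⁻¹ • cosMixed γ k := by
    rw [orthonormal_iff_ite]
    intro k l
    rw [real_inner_smul_left, real_inner_smul_right, inner_cosMixed hγ k (cosMixed_mem γ l),
      cosMixed_empty, orthonormal_iff_ite.1 orthonormal_cosL2]
    split_ifs with hkl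
    · subst hkl
      have := hsq k
      have := hs k
      field_simp
      exact (hsq k).symm
    · simp
  refine le_trans (le_of_eq (Finset.sum_congr rfl fun k _ => ?_)) (ho.sum_inner_products_le h)
  rw [real_inner_smul_left, inner_cosMixed hγ k hh, Real.norm_eq_abs, sq_abs]
  have := hs k
  nth_rw 1 [← hsq k]
  nth_rw 3 [← hsq k]
  field_simp

/-! ### Truncated cosine series -/

/-- The uniform error of a truncated cosine series on the weighted Sobolev space. -/
lemma eLpNorm_sub_cosSum_le {γ : Fin d → ℝ} (hγ : ∀ j, 0 < γ j) {K : Finset (Fin d → ℕ)} {R : ℝ}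
    (hR : ∀ s : Finset (Fin d → ℕ), Disjoint s K →
      ∑ k ∈ s, (∏ j, cosScale (k j) ^ 2) / cosWeight γ k ≤ R)
    {h : MixedL2 d} (hh : h ∈ unanchoredSobolev γ) :
    eLpNorm (fun x => h ∅ x - ∑ k ∈ K, inner ℝ (cosL2 k) (h ∅) * cosTensor k x) ∞ volume ≤
      ENNReal.ofReal (Real.sqrt R * ‖h‖) := by
  classical
  set c : (Fin d → ℕ) → ℝ := fun k => inner ℝ (cosL2 k) (h ∅) with hc
  set a : (Fin d → ℕ) → C(Cube d, ℝ) := fun k => c k • cosTensor k with ha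
  have hw : ∀ k, 0 < cosWeight γ k := fun k => zero_lt_one.trans_le (one_le_cosWeight hγ k)
  -- Cauchy–Schwarz with the factor `√w_k` moved onto the coefficient, so that Bessel applies.
  have htail : ∀ s : Finset (Fin d → ℕ), Disjoint s K →
      ∑ k ∈ s, ‖a k‖ ≤ Real.sqrt R * ‖h‖ := by
    intro s hs
    have h1 : ∀ k ∈ s, ‖a k‖ ≤ ((∏ j, cosScale (k j)) / Real.sqrt (cosWeight γ k)) *
        (Real.sqrt (cosWeight γ k) * |c k|) := by
      intro k _
      have h2 := (Real.sqrt_pos.2 (hw k)).ne'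
      rw [← mul_assoc, div_mul_cancel₀ _ h2, ha, norm_smul, mul_comm]
      exact mul_le_mul_of_nonneg_right (norm_cosTensor_le k) (abs_nonneg _)
    refine (Finset.sum_le_sum h1).trans ((Real.sum_mul_le_sqrt_mul_sqrt _ _ _).trans ?_)
    refine mul_le_mul (Real.sqrt_le_sqrt ?_) ?_ (Real.sqrt_nonneg _) (Real.sqrt_nonneg _)
    · refine le_trans (le_of_eq (Finset.sum_congr rfl fun k _ => ?_)) (hR s hs)
      rw [div_pow, Real.sq_sqrt (hw k).le, Finset.prod_pow]
    · rw [← Real.sqrt_sq (norm_nonneg h)]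
      refine Real.sqrt_le_sqrt
        (le_trans (le_of_eq (Finset.sum_congr rfl fun k _ => ?_)) (sum_cosWeight_mul_sq_le hγ hh s))
      rw [mul_pow, Real.sq_sqrt (hw k).le, sq_abs]
  have hsum : Summable a := by
    refine Summable.of_norm (summable_of_sum_le (c := ∑ k ∈ K, ‖a k‖ + Real.sqrt R * ‖h‖)
      (fun _ => norm_nonneg _) fun s => ?_)
    rw [← Finset.sum_inter_add_sum_sdiff s K]
    exact add_le_add (Finset.sum_le_sum_of_subset_of_nonneg Finset.inter_subset_right
      fun _ _ _ => norm_nonneg _) (htail _ Finset.sdiff_disjoint)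
  have herr : ‖(∑' k, a k) - ∑ k ∈ K, a k‖ ≤ Real.sqrt R * ‖h‖ := by
    refine le_of_tendsto ((hsum.hasSum.sub_const (∑ k ∈ K, a k)).norm) ?_
    filter_upwards [eventually_ge_atTop K] with s hs
    rw [← Finset.sum_sdiff hs, add_sub_cancel_right]
    exact (norm_sum_le _ _).trans (htail _ Finset.sdiff_disjoint)
  -- The uniformly convergent series is identified with `h ∅` through its `L_2` expansion.
  have hlim : ContinuousMap.toLp 2 volume ℝ (∑' k, a k) = h ∅ := by
    have h1 := hsum.hasSum.mapL (ContinuousMap.toLp 2 (volume : Measure (Cube d)) ℝ)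
    refine h1.unique ?_
    convert (cosHilbertBasis d).hasSum_repr (h ∅) using 2 with k
    rw [HilbertBasis.repr_apply_apply, cosHilbertBasis, HilbertBasis.coe_mk, ha, map_smul]
    rfl
  have hG : h ∅ =ᵐ[volume] ⇑(∑' k, a k) := hlim ▸ ContinuousMap.coeFn_toLp volume (∑' k, a k)
  rw [eLpNorm_exponent_top]
  refine eLpNormEssSup_le_of_ae_bound ?_
  filter_upwards [hG] with x hx
  refine le_trans (le_of_eq ?_) ((ContinuousMap.norm_coe_le_norm _ x).trans herr)
  rw [hx]
  simp [ha, hc, ContinuousMap.sum_apply]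

/-- The linear algorithm that truncates the cosine series to `K`. -/
lemma infoComplexity_le_card {F : Type*} [NormedAddCommGroup F] [NormedSpace ℝ F]
    {ι : F →ₗ[ℝ] (Cube d → ℝ)} {γ : Fin d → ℝ} (hγ : ∀ j, 0 < γ j) {M : ℝ} (hM : 0 ≤ M)
    (hι : EmbedsWithNormLE ι γ M) {K : Finset (Fin d → ℕ)} {R ε : ℝ}
    (hR : ∀ s : Finset (Fin d → ℕ), Disjoint s K →
      ∑ k ∈ s, (∏ j, cosScale (k j) ^ 2) / cosWeight γ k ≤ R) (hε : Real.sqrt R * M ≤ ε) :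
    infoComplexity ι ε ≤ K.card := by
  choose h hmem hae hle using hι
  -- The chosen `h` need not be linear in `f`, but its component at `∅` is, being determined almost
  -- everywhere by `ι f`.
  have hadd : ∀ f g, h (f + g) ∅ = h f ∅ + h g ∅ := fun f g => Lp.ext <| by
    filter_upwards [hae f, hae g, hae (f + g), Lp.coeFn_add (h f ∅) (h g ∅)] with x h1 h2 h3 h4
    rw [h3, h4, Pi.add_apply, h1, h2, map_add, Pi.add_apply]
  have hsmul : ∀ (r : ℝ) f, h (r • f) ∅ = r • h f ∅ := fun r f => Lp.ext <| by
    filter_upwards [hae f, hae (r • f), Lp.coeFn_smul r (h f ∅)] with x h1 h2 h3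
    rw [h2, h3, Pi.smul_apply, h1, map_smul, Pi.smul_apply]
  let J : F →L[ℝ] Lp ℝ 2 (volume : Measure (Cube d)) :=
    LinearMap.mkContinuous ⟨⟨fun f => h f ∅, hadd⟩, hsmul⟩ M
      fun f => (PiLp.norm_apply_le (h f) ∅).trans (hle f)
  let e := K.equivFin.symm
  let A : F → Linfty d := fun f => ∑ i, (innerSL ℝ (cosL2 (e i)) ∘L J) f •
    ContinuousMap.toLp ∞ volume ℝ (cosTensor (e i))
  have hA : ∀ f, A f =ᵐ[volume] fun x => ∑ k ∈ K, inner ℝ (cosL2 k) (h f ∅) * cosTensor k x := by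
    intro f
    have h1 : A f = ContinuousMap.toLp ∞ volume ℝ
        (∑ k ∈ K, inner ℝ (cosL2 k) (h f ∅) • cosTensor k) := by
      rw [map_sum, ← Finset.sum_coe_sort, ← e.sum_comp]
      simp_rw [map_smul]
      rfl
    rw [h1]
    filter_upwards [ContinuousMap.coeFn_toLp (p := ∞) (𝕜 := ℝ) (volume : Measure (Cube d))
      (∑ k ∈ K, inner ℝ (cosL2 k) (h f ∅) • cosTensor k)] with x hx
    rw [hx]
    simp [ContinuousMap.sum_apply]
  refine iInf₂_le K.card ⟨A, ⟨_, _, fun f => rfl⟩, iSup₂_le fun f hf => ?_⟩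
  have hf1 : ‖f‖ ≤ 1 := by simpa using hf
  have h2 : eLpNorm (fun x => ι f x - A f x) ∞ volume = eLpNorm (fun x => h f ∅ x -
      ∑ k ∈ K, inner ℝ (cosL2 k) (h f ∅) * cosTensor k x) ∞ volume := by
    refine eLpNorm_congr_ae ?_
    filter_upwards [hae f, hA f] with x h3 h4
    rw [h3, h4]
  rw [h2]
  refine (eLpNorm_sub_cosSum_le hγ hR (hmem f)).trans (ENNReal.ofReal_le_ofReal (le_trans ?_ hε))
  exact mul_le_mul_of_nonneg_left ((hle f).trans (mul_le_of_le_one_right hM hf1))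
    (Real.sqrt_nonneg _)

/-! ### Counting frequencies -/

/-- If `∑ m w^{-τ} ≤ E`, `τ ≤ 1`, then the set where `w ≤ T` is small, and so is the sum of `m / w`
over its complement. -/
lemma exists_finset_card_le_and_sum_div_le {I : Type*} {w m : I → ℝ} (hw : ∀ k, 0 < w k)
    (hm : ∀ k, 1 ≤ m k) {τ E T : ℝ} (hτ0 : 0 ≤ τ) (hτ : τ ≤ 1) (hT : 0 < T)
    (hE : ∀ s : Finset I, ∑ k ∈ s, m k * w k ^ (-τ) ≤ E) :
    ∃ K : Finset I, (K.card : ℝ) ≤ T ^ τ * E ∧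
      ∀ s : Finset I, Disjoint s K → ∑ k ∈ s, m k / w k ≤ T ^ (τ - 1) * E := by
  have hcard : ∀ s : Finset I, (∀ k ∈ s, w k ≤ T) → (s.card : ℝ) ≤ T ^ τ * E := by
    intro s hs
    refine le_trans ?_ (mul_le_mul_of_nonneg_left (hE s) (by positivity))
    rw [Finset.mul_sum, Finset.card_eq_sum_ones, Nat.cast_sum]
    refine Finset.sum_le_sum fun k hk => ?_
    have h1 : 1 ≤ T ^ τ * w k ^ (-τ) := by
      rw [Real.rpow_neg (hw k).le, ← div_eq_mul_inv, one_le_div (by have := hw k; positivity)]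
      exact Real.rpow_le_rpow (hw k).le (hs k hk) hτ0
    calc ((1 : ℕ) : ℝ) ≤ 1 * (T ^ τ * w k ^ (-τ)) := by simpa using h1
      _ ≤ m k * (T ^ τ * w k ^ (-τ)) := mul_le_mul_of_nonneg_right (hm k) (by linarith)
      _ = _ := by ring
  have hfin : {k | w k ≤ T}.Finite := by
    by_contra hinf
    obtain ⟨s, hs, hs2⟩ := Set.Infinite.exists_subset_card_eq hinf (⌊T ^ τ * E⌋₊ + 1)
    have h1 := hcard s fun k hk => hs hk
    rw [hs2] at h1
    push_cast at h1
    exact absurd (Nat.lt_floor_add_one (T ^ τ * E)) (not_lt.2 h1)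
  refine ⟨hfin.toFinset, hcard _ fun k hk => by simpa using hk, fun s hs => ?_⟩
  refine le_trans ?_ (mul_le_mul_of_nonneg_left (hE s) (by positivity))
  rw [Finset.mul_sum]
  refine Finset.sum_le_sum fun k hk => ?_
  have h1 : T < w k := by simpa using Finset.disjoint_left.1 hs hk
  have h2 : m k / w k = w k ^ (τ - 1) * (m k * w k ^ (-τ)) := by
    rw [mul_left_comm, ← Real.rpow_add (hw k), div_eq_mul_inv, ← Real.rpow_neg_one]
    congr 2; ring
  have h3 := hw k
  have h4 := hm k
  rw [h2]
  exact mul_le_mul_of_nonneg_right (Real.rpow_le_rpow_of_nonpos hT h1.le (by linarith))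
    (by positivity)

/-- For `τ > 1/2` the sums of `m_k w_k^{-τ}` over the frequencies `k` grow at most exponentially in
`∑_j γ_j^τ`. -/
lemma exists_sum_cosWeight_rpow_le {τ : ℝ} (hτ : 1 / 2 < τ) :
    ∃ D : ℝ, 0 ≤ D ∧ ∀ (d : ℕ) (γ : Fin d → ℝ), (∀ j, 0 < γ j) → ∀ s : Finset (Fin d → ℕ),
      ∑ k ∈ s, (∏ j, cosScale (k j) ^ 2) * cosWeight γ k ^ (-τ) ≤
        Real.exp (D * ∑ j, γ j ^ τ) := by
  -- This is where `τ > 1/2` is needed.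
  have hsum : Summable fun n : ℕ => (n : ℝ) ^ (-(2 * τ)) :=
    Real.summable_nat_rpow.2 (by linarith)
  have hnn : ∀ n : ℕ, 0 ≤ (n : ℝ) ^ (-(2 * τ)) := fun n => by positivity
  refine ⟨2 * ∑' n : ℕ, (n : ℝ) ^ (-(2 * τ)), mul_nonneg zero_le_two (tsum_nonneg hnn), ?_⟩
  intro d γ hγ s
  have h1 : ∀ g : ℝ, 0 < g → ∀ N : ℕ,
      ∑ n ∈ Finset.range N, cosScale n ^ 2 * (1 + g⁻¹ * (n * Real.pi) ^ 2) ^ (-τ) ≤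
        Real.exp (2 * (∑' n : ℕ, (n : ℝ) ^ (-(2 * τ))) * g ^ τ) := by
    intro g hg N
    have h2 : ∀ n : ℕ, cosScale n ^ 2 * (1 + g⁻¹ * (n * Real.pi) ^ 2) ^ (-τ) ≤
        (if n = 0 then 1 else 0) + 2 * g ^ τ * (n : ℝ) ^ (-(2 * τ)) := by
      intro n
      rcases eq_or_ne n 0 with rfl | hn
      · have h0 : (0 : ℝ) ≤ 2 * g ^ τ * ((0 : ℕ) : ℝ) ^ (-(2 * τ)) := by positivity
        simpa [cosScale] using h0
      · rw [cosScale_sq, if_neg hn, if_neg hn, zero_add, mul_assoc]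
        refine mul_le_mul_of_nonneg_left ?_ zero_le_two
        have hn' : (0 : ℝ) < n := by positivity
        have h3 : g ^ τ * (n : ℝ) ^ (-(2 * τ)) = (g⁻¹ * (n : ℝ) ^ 2) ^ (-τ) := by
          rw [Real.mul_rpow (by positivity) (by positivity), Real.inv_rpow hg.le,
            Real.rpow_neg hg.le, inv_inv, ← Real.rpow_natCast, ← Real.rpow_mul hn'.le]
          congr 2; push_cast; ring
        rw [h3]
        refine Real.rpow_le_rpow_of_nonpos (by positivity) ?_ (by linarith)
        have h4 : (n : ℝ) ^ 2 ≤ (n * Real.pi) ^ 2 :=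
          pow_le_pow_left₀ hn'.le (le_mul_of_one_le_right hn'.le (by linarith [Real.pi_gt_three])) 2
        have h5 := mul_le_mul_of_nonneg_left h4 (inv_nonneg.2 hg.le)
        linarith
    refine (Finset.sum_le_sum fun n _ => h2 n).trans ?_
    rw [Finset.sum_add_distrib, ← Finset.mul_sum, Finset.sum_ite_eq']
    have h6 := mul_le_mul_of_nonneg_left (hsum.sum_le_tsum (Finset.range N) fun n _ => hnn n)
      (show 0 ≤ 2 * g ^ τ by positivity)
    have h7 := Real.add_one_le_exp (2 * (∑' n : ℕ, (n : ℝ) ^ (-(2 * τ))) * g ^ τ)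
    have h8 : (if 0 ∈ Finset.range N then (1 : ℝ) else 0) ≤ 1 := by split_ifs <;> norm_num
    linarith
  -- Enlarging `s` to a box makes the sum a product of univariate sums.
  obtain ⟨N, hN⟩ : ∃ N : ℕ, s ⊆ Fintype.piFinset fun _ : Fin d => Finset.range N := by
    refine ⟨s.sup (fun k => ∑ j, k j) + 1, fun k hk => ?_⟩
    rw [Fintype.mem_piFinset]
    intro j
    rw [Finset.mem_range, Nat.lt_succ_iff]
    exact (Finset.single_le_sum (fun _ _ => Nat.zero_le _) (Finset.mem_univ j)).trans
      (Finset.le_sup (f := fun k : Fin d → ℕ => ∑ j, k j) hk)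
  have hb : ∀ j (n : ℕ), 0 ≤ 1 + (γ j)⁻¹ * (n * Real.pi) ^ 2 := fun j n => by
    have := hγ j; positivity
  have h9 : ∀ k : Fin d → ℕ, (∏ j, cosScale (k j) ^ 2) * cosWeight γ k ^ (-τ) =
      ∏ j, (cosScale (k j) ^ 2 * (1 + (γ j)⁻¹ * (k j * Real.pi) ^ 2) ^ (-τ)) := by
    intro k
    rw [Finset.prod_mul_distrib, cosWeight, Real.finsetProd_rpow _ _ fun j _ => hb j _]
  have h10 : ∀ j (n : ℕ), 0 ≤ cosScale n ^ 2 * (1 + (γ j)⁻¹ * (n * Real.pi) ^ 2) ^ (-τ) :=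
    fun j n => mul_nonneg (sq_nonneg _) (Real.rpow_nonneg (hb j n) _)
  simp_rw [h9]
  refine (Finset.sum_le_sum_of_subset_of_nonneg hN
    fun k _ _ => Finset.prod_nonneg fun j _ => h10 j _).trans ?_
  rw [← Finset.prod_univ_sum (fun _ : Fin d => Finset.range N)
    (fun j n => cosScale n ^ 2 * (1 + (γ j)⁻¹ * (n * Real.pi) ^ 2) ^ (-τ)), Finset.mul_sum,
    Real.exp_sum]
  exact Finset.prod_le_prod (fun j _ => Finset.sum_nonneg fun n _ => h10 j n)
    fun j _ => h1 _ (hγ j) N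

/-! ### Complexity bounds -/

/-- The threshold `T = (M² E / ε²)^{1/(1-τ)}` solves `T^{τ-1} E = (ε / M)²`, so the error is at most
`ε`; the bound is then `T^τ E`. -/
lemma infoComplexity_le_ofReal {F : Type*} [NormedAddCommGroup F] [NormedSpace ℝ F]
    {ι : F →ₗ[ℝ] (Cube d → ℝ)} {γ : Fin d → ℝ} (hγ : ∀ j, 0 < γ j) {M E τ ε : ℝ} (hM : 0 < M)
    (hι : EmbedsWithNormLE ι γ M) (hE0 : 0 < E) (hτ0 : 0 ≤ τ) (hτ : τ < 1)
    (hE : ∀ s : Finset (Fin d → ℕ),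
      ∑ k ∈ s, (∏ j, cosScale (k j) ^ 2) * cosWeight γ k ^ (-τ) ≤ E) (hε : 0 < ε) :
    (infoComplexity ι ε : ℝ≥0∞) ≤
      ENNReal.ofReal ((M ^ 2 * E / ε ^ 2) ^ (τ / (1 - τ)) * E) := by
  have h1τ : 0 < 1 - τ := by linarith
  have hX : 0 < M ^ 2 * E / ε ^ 2 := by positivity
  obtain ⟨K, hK, hR⟩ := exists_finset_card_le_and_sum_div_le
    (fun k => zero_lt_one.trans_le (one_le_cosWeight hγ k))
    (fun k => Finset.one_le_prod (s := Finset.univ) fun j _ => by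
      rw [cosScale_sq]; split_ifs <;> norm_num) hτ0 hτ.le
    (Real.rpow_pos_of_pos hX (1 / (1 - τ))) hE
  have hT1 : ((M ^ 2 * E / ε ^ 2) ^ (1 / (1 - τ))) ^ τ = (M ^ 2 * E / ε ^ 2) ^ (τ / (1 - τ)) := by
    rw [← Real.rpow_mul hX.le]; congr 1; ring
  have hT2 : ((M ^ 2 * E / ε ^ 2) ^ (1 / (1 - τ))) ^ (τ - 1) * E = (ε / M) ^ 2 := by
    have h2 : 1 / (1 - τ) * (τ - 1) = -1 := by field_simp; ring
    rw [← Real.rpow_mul hX.le, h2, Real.rpow_neg_one]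
    field_simp
  rw [hT1] at hK
  have hn := infoComplexity_le_card hγ hM.le hι hR (ε := ε) (by
    rw [hT2, Real.sqrt_sq (by positivity), div_mul_cancel₀ _ hM.ne'])
  calc (infoComplexity ι ε : ℝ≥0∞) ≤ ((K.card : ℕ∞) : ℝ≥0∞) := by exact_mod_cast hn
    _ = ENNReal.ofReal K.card := by simp
    _ ≤ _ := ENNReal.ofReal_le_ofReal hK

lemma sum_rpow_le_mul_sum_rpow {I : Type*} (s : Finset I) {γ : I → ℝ} {c κ τ : ℝ}
    (hγ : ∀ j, 0 < γ j) (hc : ∀ j, γ j ≤ c) (hκ : κ ≤ τ) :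
    ∑ j ∈ s, γ j ^ τ ≤ c ^ (τ - κ) * ∑ j ∈ s, γ j ^ κ := by
  rw [Finset.mul_sum]
  refine Finset.sum_le_sum fun j _ => ?_
  have h1 : γ j ^ τ = γ j ^ (τ - κ) * γ j ^ κ := by
    rw [← Real.rpow_add (hγ j)]; congr 1; ring
  rw [h1]
  exact mul_le_mul_of_nonneg_right (Real.rpow_le_rpow (hγ j).le (hc j) (by linarith))
    (Real.rpow_nonneg (hγ j).le _)

/-- The information complexity grows polynomially in `ε⁻¹` and at most exponentially in
`∑_j γ_j^κ`, for every `κ < t`. -/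
lemma exists_infoComplexity_le {γ : (d : ℕ) → Fin d → ℝ} {Cγ : ℝ}
    (hγ_pos : ∀ d j, 0 < γ d j) (hγ_le : ∀ d j, γ d j ≤ Cγ)
    {F : ℕ → Type*} [∀ d, NormedAddCommGroup (F d)] [∀ d, NormedSpace ℝ (F d)]
    {ι : ∀ d, F d →ₗ[ℝ] (Cube d → ℝ)} {a b t κ : ℝ} (ha : 0 < a) (hb : 0 ≤ b)
    (ht1 : t ≤ 1) (hκ : κ < t)
    (hemb : ∀ d, 1 ≤ d → EmbedsWithNormLE (ι d) (γ d) (a * Real.exp (b * ∑ j, γ d j ^ t))) :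
    ∃ A B p : ℝ, 0 < A ∧ 0 ≤ B ∧ 0 < p ∧ ∀ d : ℕ, 1 ≤ d → ∀ ε : ℝ, 0 < ε →
      (infoComplexity (ι d) ε : ℝ≥0∞) ≤
        ENNReal.ofReal (A * Real.exp (B * ∑ j, γ d j ^ κ) * ε ^ (-p)) := by
  have hCγ : 0 < Cγ := (hγ_pos 1 0).trans_le (hγ_le 1 0)
  -- Any `τ` in `(1/2, 1)` with `τ ≥ κ` works; it exists because `κ < t ≤ 1`.
  obtain ⟨τ, hτκ, hτ2, hτ1⟩ : ∃ τ : ℝ, κ ≤ τ ∧ 1 / 2 < τ ∧ τ < 1 :=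
    ⟨max κ (3 / 4), le_max_left _ _, lt_max_of_lt_right (by norm_num),
      max_lt (hκ.trans_le ht1) (by norm_num)⟩
  obtain ⟨D, hD, hsum⟩ := exists_sum_cosWeight_rpow_le hτ2
  set θ := τ / (1 - τ) with hθ
  have hθ0 : 0 < θ := div_pos (by linarith) (by linarith)
  refine ⟨a ^ (2 * θ), θ * (2 * b * Cγ ^ (t - κ) + D * Cγ ^ (τ - κ)) + D * Cγ ^ (τ - κ), 2 * θ,
    by positivity, by positivity, by positivity, fun d hd ε hε => ?_⟩
  refine (infoComplexity_le_ofReal (hγ_pos d) (by positivity) (hemb d hd) (Real.exp_pos _)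
    (by linarith) hτ1 (hsum d (γ d) (hγ_pos d)) hε).trans (ENNReal.ofReal_le_ofReal ?_)
  set P := ∑ j, γ d j ^ t
  set Q := ∑ j, γ d j ^ τ
  set S := ∑ j, γ d j ^ κ
  have hP : P ≤ Cγ ^ (t - κ) * S := sum_rpow_le_mul_sum_rpow _ (hγ_pos d) (hγ_le d) hκ.le
  have hQ : Q ≤ Cγ ^ (τ - κ) * S := sum_rpow_le_mul_sum_rpow _ (hγ_pos d) (hγ_le d) hτκ
  have h1 : ((a * Real.exp (b * P)) ^ 2 * Real.exp (D * Q) / ε ^ 2) ^ θ * Real.exp (D * Q) =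
      a ^ (2 * θ) * Real.exp (θ * (2 * (b * P) + D * Q) + D * Q) * ε ^ (-(2 * θ)) := by
    have h2 : (a * Real.exp (b * P)) ^ 2 * Real.exp (D * Q) / ε ^ 2 =
        a ^ 2 * Real.exp (2 * (b * P) + D * Q) * (ε ^ 2)⁻¹ := by
      rw [mul_pow, ← Real.exp_nat_mul, mul_assoc, ← Real.exp_add, div_eq_mul_inv]; norm_num
    rw [h2, Real.mul_rpow (by positivity) (by positivity),
      Real.mul_rpow (by positivity) (by positivity), ← Real.exp_mul, Real.exp_add,
      Real.inv_rpow (by positivity), Real.rpow_neg hε.le, ← Real.rpow_natCast,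
      ← Real.rpow_natCast, ← Real.rpow_mul ha.le, ← Real.rpow_mul hε.le, mul_comm θ]
    push_cast
    ring
  rw [h1]
  have h3 : θ * (2 * (b * P) + D * Q) + D * Q ≤
      (θ * (2 * b * Cγ ^ (t - κ) + D * Cγ ^ (τ - κ)) + D * Cγ ^ (τ - κ)) * S := by
    have h4 := mul_le_mul_of_nonneg_left hP hb
    have h5 := mul_le_mul_of_nonneg_left hQ hD
    have h6 := mul_le_mul_of_nonneg_left (add_le_add (mul_le_mul_of_nonneg_left h4 zero_le_two) h5)
      hθ0.le
    linarith
  gcongr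

/-- A finite limsup bounds all but finitely many terms, and the remaining real terms only enlarge
the constant. -/
lemma exists_forall_le_of_limsup_lt_top {u : ℕ → ℝ}
    (hu : limsup (fun d => (u d : EReal)) atTop < ⊤) : ∃ B : ℝ, 0 ≤ B ∧ ∀ d, u d ≤ B := by
  obtain ⟨c, hc, -⟩ := EReal.lt_iff_exists_real_btwn.1 hu
  have h1 : IsBoundedUnder (· ≤ ·) atTop u :=
    ⟨c, eventually_map.2 ((eventually_lt_of_limsup_lt hc).mono
      fun d hd => (EReal.coe_lt_coe_iff.1 hd).le)⟩
  obtain ⟨B, hB⟩ := h1.bddAbove_range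
  exact ⟨max B 0, le_max_right _ _, fun d => (hB ⟨d, rfl⟩).trans (le_max_left _ _)⟩

end LinftyApp

theorem proposition4p7
    (γ : (d : ℕ) → Fin d → ℝ) (Cγ : ℝ)
    (hγ_pos : ∀ d j, 0 < γ d j) (hγ_le : ∀ d j, γ d j ≤ Cγ) (hγ_anti : ∀ d, Antitone (γ d))
    (F : ℕ → Type*) [∀ d, NormedAddCommGroup (F d)] [∀ d, NormedSpace ℝ (F d)]
    [∀ d, CompleteSpace (F d)]
    (ι : ∀ d, F d →ₗ[ℝ] (LinftyApp.Cube d → ℝ))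
    (hι : ∀ d, 1 ≤ d → Function.Injective (ι d))
    (a b t : ℝ) (ha : 0 < a) (hb : 0 ≤ b) (ht0 : 0 < t) (ht1 : t ≤ 1)
    (hemb : ∀ d, 1 ≤ d →
      LinftyApp.EmbedsWithNormLE (ι d) (γ d) (a * Real.exp (b * ∑ j, γ d j ^ t))) :
    (LinftyApp.sumExponentQ γ < (t : EReal) → LinftyApp.PolynomiallyTractable ι) ∧
    (LinftyApp.sumExponentP γ < (t : EReal) → LinftyApp.StronglyPolynomiallyTractable ι) := by
  constructor
  · intro h
    obtain ⟨_, ⟨κ, ⟨-, hlim⟩, rfl⟩, hκ⟩ := sInf_lt_iff.1 h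
    obtain ⟨A, B, p, hA, hB, hp, hn⟩ := LinftyApp.exists_infoComplexity_le hγ_pos hγ_le ha hb ht1
      (EReal.coe_lt_coe_iff.1 hκ) hemb
    obtain ⟨B', hB', hS⟩ := LinftyApp.exists_forall_le_of_limsup_lt_top hlim
    refine ⟨A * 2 ^ (B * B'), p, B * B', by positivity, hp, by positivity, fun d hd ε hε _ =>
      (hn d hd ε hε).trans (ENNReal.ofReal_le_ofReal ?_)⟩
    have hd1 : (1 : ℝ) ≤ d := by exact_mod_cast hd
    have hS1 := (div_le_iff₀ (Real.log_pos (by linarith))).1 (hS d)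
    -- The logarithmic bound turns the exponential into `(d + 1)^{B B'}`, and `d + 1 ≤ 2 d` as `d ≥
    -- 1`.
    have h1 : Real.exp (B * ∑ j, γ d j ^ κ) ≤ 2 ^ (B * B') * (d : ℝ) ^ (B * B') := by
      calc Real.exp (B * ∑ j, γ d j ^ κ) ≤ Real.exp (Real.log ((d : ℝ) + 1) * (B * B')) :=
            Real.exp_le_exp.2 (by nlinarith [mul_le_mul_of_nonneg_left hS1 hB])
        _ = ((d : ℝ) + 1) ^ (B * B') := (Real.rpow_def_of_pos (by linarith) _).symm
        _ ≤ (2 * d) ^ (B * B') := Real.rpow_le_rpow (by linarith) (by linarith) (by positivity)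
        _ = _ := Real.mul_rpow zero_le_two (by linarith)
    calc _ ≤ A * (2 ^ (B * B') * (d : ℝ) ^ (B * B')) * ε ^ (-p) := by gcongr
      _ = _ := by ring
  · intro h
    obtain ⟨_, ⟨κ, ⟨-, hlim⟩, rfl⟩, hκ⟩ := sInf_lt_iff.1 h
    obtain ⟨A, B, p, hA, hB, hp, hn⟩ := LinftyApp.exists_infoComplexity_le hγ_pos hγ_le ha hb ht1
      (EReal.coe_lt_coe_iff.1 hκ) hemb
    obtain ⟨B', -, hS⟩ := LinftyApp.exists_forall_le_of_limsup_lt_top hlim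
    refine ⟨A * Real.exp (B * B'), p, by positivity, hp, fun d hd ε hε _ =>
      (hn d hd ε hε).trans (ENNReal.ofReal_le_ofReal ?_)⟩
    have hS1 := hS d
    gcongr
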